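/- Let $N,q\ge 0$ be integers and let $(\mathcal V,\mathcal E)$ be a directed acyclic graph with $\mathcal V=\{1,\dots,N,d\}$, where each edge $(i,j)\in\mathcal E$ carries a matrix $\mathbf S_{i,j}\in\mathbb F_2^{q\times q}$. At each time $t$, node $i$ sends $\mathbf x_i[t]\in\mathbb F_2^q$ and node $j$ receives $\mathbf y_j[t]=\sum_{i:(i,j)\in\mathcal E}\mathbf S_{i,j}\mathbf x_i[t]$; the destination $d$ is silent ($\mathbf x_d[t]=0$). For rates $R_1,\dots,R_N\ge 0$ and block length $T$, node $i\in\{1,\dots,N\}$ has a message $W_i$, and $W_1,\dots,W_N$ are independent and uniform on the sets $\mathcal W_i=\{1,\dots,\lceil 2^{TR_i}\rceil\}$. A $(T,R_1,\dots,R_N)$ code consists of strictly causal encoders, $\mathbf x_i[t]=f_i^{[t]}(W_i,\mathbf y_i[1],\dots,\mathbf y_i[t-1])$ for $1\le i\le N$ and $1\le t\le T$, and a decoder $(\widehat W_1,\dots,\widehat W_N)=g(\mathbf y_d[1],\dots,\mathbf y_d[T])$. The tuple $(R_1,\dots,R_N)$ is achievable if there are $(T,R_1,\dots,R_N)$ codes,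 $T=1,2,\dots$, with $\Pr\big((\widehat W_1,\dots,\widehat W_N)\ne(W_1,\dots,W_N)\big)\to 0$ as $T\to\infty$. The capacity region $\mathcal C$ is the closure of the set of achievable rate tuples. For $\mathcal S\subseteq\{1,\dots,N\}$ let $\mathcal S^c=\mathcal V\setminus\mathcal S$ (so $d\in\mathcal S^c$), and let $\mathbf G_{\mathcal S,\mathcal S^c}$ be the matrix over $\mathbb F_2$ of the linear map from the inputs of the nodes of $\mathcal S$ having an edge to $\mathcal S^c$ to the outputs of the nodes of $\mathcal S^c$ having an edge from $\mathcal S$, that is, the block matrix with block $\mathbf S_{i,j}$ from $i$ to $j$ if $(i,j)\in\mathcal E$ and $0$ otherwise. Theorem. $$\mathcal C=\Big\{(R_1,\dots,R_N)\in\mathbb R_{\ge 0}^N:\ \sum_{i\in\mathcal S}R_i\le\operatorname{rank}\mathbf G_{\mathcal S,\mathcal S^c}\ \text{ for every }\mathcal S\subseteq\{1,\dots,N\}\Big\}.$$ -/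

import Mathlib

noncomputable section

namespace DetNet

/-- The nodes `1, …, N` (as `some i`) together with the destination `d` (as `none`). -/
abbrev Node (N : ℕ) : Type := Option (Fin N)

/-- Channel inputs and outputs: vectors of `q` bits. -/
abbrev Vec (q : ℕ) : Type := Fin q → ZMod 2

/-- A linear finite-field deterministic network: a directed acyclic graph on the nodes
`1, …, N, d` with a `q × q` matrix over `𝔽₂` on every edge. The value of `chan i j` at a pair
that is not an edge is never used. -/
structure Network (N q : ℕ) where
  Edge : Node N → Node N → Prop
  acyclic : ∀ v, ¬ Relation.TransGen Edge v v
  chan : Node N → Node N → Matrix (Fin q) (Fin q) (ZMod 2)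

variable {N q T : ℕ}

open Classical in
/-- The signal received by node `j` when every node `i` sends `x i`: the sum over the edges
`(i, j)` of the channel matrix of the edge applied to `x i`. -/
def Network.output (net : Network N q) (x : Node N → Vec q) (j : Node N) : Vec q :=
  ∑ i with net.Edge i j, (net.chan i j).mulVec (x i)

/-- A set `S` of source nodes, regarded as a side (not containing `d`) of a cut of the node set. -/
def side (S : Finset (Fin N)) : Set (Node N) := some '' (S : Set (Fin N))

/-- Inner boundary of a set of nodes: the members with an edge to the complement. -/
def Network.innerBoundary (net : Network N q) (A : Set (Node N)) : Set (Node N) :=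
  {i | i ∈ A ∧ ∃ j, j ∉ A ∧ net.Edge i j}

/-- Outer boundary of a set of nodes: the nonmembers with an edge from the set. -/
def Network.outerBoundary (net : Network N q) (A : Set (Node N)) : Set (Node N) :=
  {j | j ∉ A ∧ ∃ i, i ∈ A ∧ net.Edge i j}

open Classical in
/-- The transfer matrix of the cut `(A, Aᶜ)`: the matrix of the linear map from the inputs of the
inner boundary of `A` to the outputs of the outer boundary of `A`. -/
def Network.transfer (net : Network N q) (A : Set (Node N)) :
    Matrix (net.outerBoundary A × Fin q) (net.innerBoundary A × Fin q) (ZMod 2) :=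
  fun r c => if net.Edge c.1 r.1 then net.chan c.1 r.1 r.2 c.2 else 0

open Classical in
/-- `rank G_{S, Sᶜ}` for a set `S` of source nodes. -/
def Network.cutRank (net : Network N q) (S : Finset (Fin N)) : ℕ :=
  (net.transfer (side S)).rank

/-- Size `⌈2 ^ (T R)⌉` of the message set for block length `T` and rate `R`. -/
def msgCard (T : ℕ) (R : ℝ) : ℕ := ⌈(2 : ℝ) ^ ((T : ℝ) * R)⌉₊

/-- The tuples of messages of the nodes `1, …, N`. -/
abbrev Msg (T : ℕ) (R : Fin N → ℝ) : Type := (i : Fin N) → Fin (msgCard T (R i))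

/-- A `(T, R₁, …, R_N)` code. Time runs over `0, …, T - 1`; at time `t` the encoder of a node
sees its message and its `t` earlier channel outputs. -/
structure Code (N q T : ℕ) (R : Fin N → ℝ) where
  enc : (i : Fin N) → (t : Fin T) → Fin (msgCard T (R i)) → (Fin (t : ℕ) → Vec q) → Vec q
  dec : (Fin T → Vec q) → Msg T R

/-- The signal received at time `t` by node `j` when the messages are `w`. The destination has
no encoder and is silent. -/
def Network.received (net : Network N q) {R : Fin N → ℝ} (c : Code N q T R) (w : Msg T R)
    (t : Fin T) (j : Node N) : Vec q :=
  net.output (fun v => match v with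
    | none => 0
    | some i => c.enc i t (w i) fun s => net.received c w ⟨s, s.2.trans t.2⟩ (some i)) j
termination_by (t : ℕ)
decreasing_by exact s.2

/-- The messages that the destination decodes when the messages are `w`. -/
def Network.decoded (net : Network N q) {R : Fin N → ℝ} (c : Code N q T R) (w : Msg T R) :
    Msg T R :=
  c.dec fun t => net.received c w t none

/-- Average probability of error when the messages are independent and uniform, that is, when
the message tuple is uniform: the fraction of message tuples that are decoded wrongly. -/
def Network.errorProb (net : Network N q) {R : Fin N → ℝ} (c : Code N q T R) : ℝ :=
  ((Finset.univ.filter fun w : Msg T R => net.decoded c w ≠ w).card : ℝ) /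
    (Fintype.card (Msg T R) : ℝ)

/-- A tuple of (nonnegative) rates is achievable if it admits codes, one for every block length,
whose average probability of error tends to zero. -/
def Network.Achievable (net : Network N q) (R : Fin N → ℝ) : Prop :=
  (∀ i, 0 ≤ R i) ∧ ∃ c : (T : ℕ) → Code N q T R,
    Filter.Tendsto (fun T => net.errorProb (c T)) Filter.atTop (nhds 0)

/-- The capacity region: the closure of the set of achievable rate tuples. -/
def Network.capacityRegion (net : Network N q) : Set (Fin N → ℝ) :=
  closure {R | net.Achievable R}

end DetNet

end

/-! Converse: for a fixed cut, a correctly decoded message tuple is recovered from the messages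
outside `S` and the signals crossing the cut, since these determine everything received outside. At
most `2 ^ (T * cutRank S)` signal sequences cross, so the success probability decays exponentially
once the rate sum exceeds the rank.

Achievability: at each time every source node applies a uniformly random map to all it knows. For
two message tuples differing exactly on `S`, let `A` be the set of source nodes whose knowledge
differs; `A` contains `S` and never shrinks. In one step, nothing outside `A` sees a difference with
probability at most `2 ^ (-cutRank A)` (`card_layer_mul_le`); otherwise the destination separates
the pair or `A` gains a node. Give a confused pair the weight `δ ^ |A|`: each step multiplies its
expectation by at most `2 ^ (-cutRank A) + δ ≤ μ S`, and the final weight is at least `δ ^ N`, a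
loss independent of `T`. Summing over pairs at the rates `θ * R` with `θ < 1`, and taking `μ S = 2 ^
(-∑ i ∈ S, R i) + δ` with `δ` small, makes the error vanish; then `θ → 1`. -/

noncomputable section

namespace DetNet

variable {N q T : ℕ}

/-! ### Linear algebra of a cut -/

section Cut

variable (net : Network N q)

lemma Network.output_eq_sum (x : Node N → Vec q) (j : Node N) (k : Fin q) [DecidableRel net.Edge] :
    net.output x j k = ∑ i, if net.Edge i j then ∑ l, net.chan i j k l * x i l else 0 := by
  classical
  rw [Network.output, Finset.sum_filter, Finset.sum_apply]
  refine Finset.sum_congr rfl fun i _ => ?_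
  by_cases h : net.Edge i j <;> simp [h, Matrix.mulVec, dotProduct]

lemma Network.output_sub (x y : Node N → Vec q) (j : Node N) :
    net.output (x - y) j = net.output x j - net.output y j := by
  simp [Network.output, Matrix.mulVec_sub, Finset.sum_sub_distrib]

open Classical in
/-- The restriction of inputs to a set of nodes, the other nodes being silent. -/
def mask (A : Set (Node N)) : (Node N → Vec q) →ₗ[ZMod 2] (Node N → Vec q) where
  toFun x := A.indicator x
  map_add' _ _ := Set.indicator_add _ _ _
  map_smul' c x := Set.indicator_const_smul A c x

/-- The linear map from the inputs of all nodes to the outputs of all nodes. -/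
def Network.outputMap : (Node N → Vec q) →ₗ[ZMod 2] (Node N → Vec q) where
  toFun x := net.output x
  map_add' x y := by
    ext1 j; simp [Network.output, Matrix.mulVec_add, Finset.sum_add_distrib]
  map_smul' c x := by
    ext1 j; simp [Network.output, Matrix.mulVec_smul, Finset.smul_sum]

/-- The part of the outputs outside `A` that is due to the inputs of `A`. -/
def Network.cutMap (A : Set (Node N)) : (Node N → Vec q) →ₗ[ZMod 2] (Node N → Vec q) :=
  mask Aᶜ ∘ₗ net.outputMap ∘ₗ mask A

lemma Network.cutMap_apply_of_notMem {A : Set (Node N)} (x : Node N → Vec q) {j : Node N}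
    (hj : j ∉ A) : net.cutMap A x j = net.output (A.indicator x) j := by
  simp [Network.cutMap, mask, Network.outputMap, hj]

lemma Network.cutMap_apply_of_mem {A : Set (Node N)} (x : Node N → Vec q) {j : Node N}
    (hj : j ∈ A) : net.cutMap A x j = 0 := by
  simp [Network.cutMap, mask, hj]

lemma Network.output_eq_cutMap_add {A : Set (Node N)} (x : Node N → Vec q) {j : Node N}
    (hj : j ∉ A) : net.output x j = net.cutMap A x j + net.output (Aᶜ.indicator x) j := by
  rw [net.cutMap_apply_of_notMem x hj]
  have := congrFun (net.outputMap.map_add (A.indicator x) (Aᶜ.indicator x)) j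
  rw [Set.indicator_self_add_compl] at this
  exact this

-- The cut map is restriction to the inner boundary (onto), then the transfer matrix, then extension
-- by zero (injective), so the rank is unchanged.
open Classical in
lemma Network.finrank_range_cutMap (S : Finset (Fin N)) :
    Module.finrank (ZMod 2) (LinearMap.range (net.cutMap (side S))) = net.cutRank S := by
  set A := side S
  let res : (Node N → Vec q) →ₗ[ZMod 2] (net.innerBoundary A × Fin q → ZMod 2) :=
    { toFun := fun x c => x c.1 c.2
      map_add' := fun _ _ => rfl
      map_smul' := fun _ _ => rfl }
  let ext : (net.outerBoundary A × Fin q → ZMod 2) →ₗ[ZMod 2] (Node N → Vec q) :=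
    { toFun := fun y j k => if h : j ∈ net.outerBoundary A then y (⟨j, h⟩, k) else 0
      map_add' := fun x y => by ext j k; by_cases h : j ∈ net.outerBoundary A <;> simp [h]
      map_smul' := fun c x => by ext j k; by_cases h : j ∈ net.outerBoundary A <;> simp [h] }
  have hres : LinearMap.range res = ⊤ := by
    rw [LinearMap.range_eq_top]
    intro y
    refine ⟨fun j k => if h : j ∈ net.innerBoundary A then y (⟨j, h⟩, k) else 0, ?_⟩
    ext ⟨⟨j, hj⟩, k⟩
    simp [res, hj]
  have hext : Function.Injective ext := by
    intro y z hyz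
    ext ⟨⟨j, hj⟩, k⟩
    simpa [ext, hj] using congrFun (congrFun hyz j) k
  have hcomp : net.cutMap A = ext ∘ₗ (net.transfer A).mulVecLin ∘ₗ res := by
    refine LinearMap.ext fun x => ?_
    ext j k
    by_cases hj : j ∈ A
    · have : j ∉ net.outerBoundary A := fun h => h.1 hj
      simp [net.cutMap_apply_of_mem x hj, ext, this]
    rw [net.cutMap_apply_of_notMem x hj, net.output_eq_sum]
    by_cases h : j ∈ net.outerBoundary A
    · simp only [ext, res, h, LinearMap.comp_apply, LinearMap.coe_mk, AddHom.coe_mk, dif_pos,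
        Matrix.mulVecLin_apply, Matrix.mulVec, dotProduct, Network.transfer, Fintype.sum_prod_type]
      refine (Fintype.sum_of_injective Subtype.val Subtype.val_injective _ _ ?_ ?_).symm
      · intro i hi
        by_cases he : net.Edge i j
        · have : i ∉ A := fun hA => hi ⟨⟨i, hA, j, hj, he⟩, rfl⟩
          simp [this]
        · simp [he]
      · intro i
        have : (i : Node N) ∈ A := i.2.1
        by_cases he : net.Edge i j <;> simp [he, this]
    · simp only [ext, h, LinearMap.comp_apply, LinearMap.coe_mk, AddHom.coe_mk, dif_neg,
        not_false_eq_true]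
      refine Finset.sum_eq_zero fun i _ => ?_
      by_cases hi : i ∈ A
      · have : ¬ net.Edge i j := fun he => h ⟨hj, i, hi, he⟩
        simp [this]
      · simp [hi]
  rw [hcomp, LinearMap.range_comp, LinearMap.range_comp, hres, Submodule.map_top,
    ← (Submodule.equivMapOfInjective ext hext _).finrank_eq]
  rfl

end Cut

/-! ### Causality -/

section Execution

variable (net : Network N q) {R : Fin N → ℝ}

/-- The inputs of all nodes at time `t`. -/
def Network.sent (c : Code N q T R) (w : Msg T R) (t : Fin T) : Node N → Vec q
  | none => 0
  | some i => c.enc i t (w i) fun s => net.received c w ⟨s, s.2.trans t.2⟩ (some i)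

lemma Network.received_eq (c : Code N q T R) (w : Msg T R) (t : Fin T) (j : Node N) :
    net.received c w t j = net.output (net.sent c w t) j := by
  rw [Network.received]
  rfl

lemma Network.received_congr {c c' : Code N q T R} (w : Msg T R) (t : ℕ)
    (h : ∀ i (s : Fin T), (s : ℕ) ≤ t → c.enc i s = c'.enc i s) :
    ∀ (s : Fin T), (s : ℕ) ≤ t → net.received c w s = net.received c' w s := by
  rintro ⟨s, hs⟩
  induction s using Nat.strong_induction_on with
  | _ s ih =>
    intro hst
    ext1 j
    rw [net.received_eq, net.received_eq]
    congr 1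
    ext1 v
    cases v with
    | none => rfl
    | some i =>
      simp only [Network.sent]
      rw [h i _ hst]
      congr 1
      ext1 r
      exact congrFun (ih r r.2 _ (r.2.le.trans hst)) _

/-- The outputs outside a cut are determined by the messages outside the cut and by the signals
that cross the cut. -/
lemma Network.received_eq_of_cutMap_eq (c : Code N q T R) (S : Finset (Fin N)) {w w' : Msg T R}
    (hw : ∀ i, i ∉ S → w i = w' i)
    (h : ∀ t, net.cutMap (side S) (net.sent c w t) = net.cutMap (side S) (net.sent c w' t)) :
    ∀ (t : Fin T) (j : Node N), j ∉ side S → net.received c w t j = net.received c w' t j := by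
  rintro ⟨t, ht⟩
  induction t using Nat.strong_induction_on with
  | _ t ih =>
    intro j hj
    rw [net.received_eq, net.received_eq, net.output_eq_cutMap_add _ hj,
      net.output_eq_cutMap_add (net.sent c w' _) hj, h]
    congr 2
    -- Inputs outside the cut depend only on messages outside and on earlier outputs there, which
    -- agree by induction.
    ext1 v
    by_cases hv : v ∈ side S
    · simp [hv]
    · simp only [Set.indicator_of_mem (show v ∈ (side S)ᶜ from hv)]
      cases v with
      | none => rfl
      | some i =>
        simp only [Network.sent]
        rw [hw i fun hi => hv ⟨i, hi, rfl⟩]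
        congr 1
        ext1 s
        exact ih s s.2 _ _ hv

end Execution

/-! ### Cut-set bound by counting -/

section Converse

variable (net : Network N q) {R : Fin N → ℝ}

instance (R : Fin N → ℝ) : Nonempty (Msg T R) :=
  ⟨fun _ => ⟨0, Nat.ceil_pos.2 (by positivity)⟩⟩

lemma card_range_cutMap (S : Finset (Fin N)) :
    Nat.card (LinearMap.range (net.cutMap (side S))) = 2 ^ net.cutRank S := by
  rw [Module.natCard_eq_pow_finrank (K := ZMod 2), net.finrank_range_cutMap, Nat.card_zmod]

/-- The messages that are decoded correctly are determined by the messages outside a cut and by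
the signals that cross the cut. -/
lemma Network.card_decoded_eq_le (c : Code N q T R) (S : Finset (Fin N)) :
    (Finset.univ.filter fun w : Msg T R => net.decoded c w = w).card ≤
      (∏ i ∈ Sᶜ, msgCard T (R i)) * (2 ^ net.cutRank S) ^ T := by
  classical
  let F : {w : Msg T R // net.decoded c w = w} →
      ((i : {i // i ∈ Sᶜ}) → Fin (msgCard T (R i))) ×
        (Fin T → LinearMap.range (net.cutMap (side S))) :=
    fun w => (fun i => w.1 i, fun t => ⟨net.cutMap (side S) (net.sent c w.1 t), _, rfl⟩)
  have hF : Function.Injective F := by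
    rintro ⟨w, hw⟩ ⟨w', hw'⟩ h
    have h1 : ∀ i, i ∉ S → w i = w' i := fun i hi =>
      congrFun (congrArg Prod.fst h) ⟨i, Finset.mem_compl.2 hi⟩
    have h2 : ∀ t, net.cutMap (side S) (net.sent c w t) =
        net.cutMap (side S) (net.sent c w' t) := fun t =>
      congrArg Subtype.val (congrFun (congrArg Prod.snd h) t)
    have h3 := net.received_eq_of_cutMap_eq c S h1 h2
    have h4 : net.decoded c w = net.decoded c w' := by
      unfold Network.decoded
      congr 1
      ext1 t
      exact h3 t none (by simp [side])
    exact Subtype.ext (hw.symm.trans (h4.trans hw'))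
  have := Nat.card_le_card_of_injective F hF
  rwa [Nat.card_prod, Nat.card_pi, Nat.card_pi, card_range_cutMap, Finset.prod_const,
    Finset.card_univ, Fintype.card_fin, Nat.card_eq_fintype_card, Fintype.card_subtype,
    Finset.prod_congr rfl fun i _ => Nat.card_fin _,
    Finset.prod_coe_sort Sᶜ fun i => msgCard T (R i)] at this

lemma card_msg (T : ℕ) (R : Fin N → ℝ) (S : Finset (Fin N)) :
    Fintype.card (Msg T R) = (∏ i ∈ S, msgCard T (R i)) * ∏ i ∈ Sᶜ, msgCard T (R i) := by
  simp [Finset.prod_mul_prod_compl]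

lemma Network.one_sub_errorProb (c : Code N q T R) :
    1 - net.errorProb c =
      ((Finset.univ.filter fun w : Msg T R => net.decoded c w = w).card : ℝ) /
        (Fintype.card (Msg T R) : ℝ) := by
  have h : (0 : ℝ) < Fintype.card (Msg T R) := by exact_mod_cast Fintype.card_pos
  rw [Network.errorProb, eq_div_iff h.ne', sub_mul, div_mul_cancel₀ _ h.ne', one_mul,
    sub_eq_iff_eq_add, ← Finset.card_univ,
    ← Finset.card_filter_add_card_filter_not (s := Finset.univ)
      (fun w : Msg T R => net.decoded c w = w)]
  push_cast
  rfl

/-- The message counts outside `S` cancel, and rounding up the counts inside `S` only helps. -/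
lemma Network.one_sub_errorProb_le (c : Code N q T R) (S : Finset (Fin N)) :
    1 - net.errorProb c ≤ ((2 : ℝ) ^ ((net.cutRank S : ℝ) - ∑ i ∈ S, R i)) ^ T := by
  have hpos (i : Fin N) : (0 : ℝ) < msgCard T (R i) := by
    exact_mod_cast Nat.ceil_pos.2 (by positivity)
  have h1 : ((Finset.univ.filter fun w : Msg T R => net.decoded c w = w).card : ℝ) ≤
      (∏ i ∈ Sᶜ, (msgCard T (R i) : ℝ)) * (2 ^ net.cutRank S) ^ T := by
    exact_mod_cast net.card_decoded_eq_le c S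
  have h2 : ((2 : ℝ) ^ (∑ i ∈ S, R i)) ^ T ≤ ∏ i ∈ S, (msgCard T (R i) : ℝ) := by
    rw [← Real.rpow_natCast, ← Real.rpow_mul two_pos.le, mul_comm, Finset.mul_sum,
      Real.rpow_sum_of_pos two_pos]
    exact Finset.prod_le_prod (fun _ _ => by positivity) fun i _ => Nat.le_ceil _
  have h3 : (0 : ℝ) < ∏ i ∈ Sᶜ, (msgCard T (R i) : ℝ) := Finset.prod_pos fun i _ => hpos i
  have h4 : (0 : ℝ) < ∏ i ∈ S, (msgCard T (R i) : ℝ) := Finset.prod_pos fun i _ => hpos i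
  rw [net.one_sub_errorProb, card_msg T R S, Real.rpow_sub two_pos, div_pow, Real.rpow_natCast]
  push_cast
  rw [div_le_div_iff₀ (by positivity) (by positivity)]
  calc _ ≤ ((∏ i ∈ Sᶜ, (msgCard T (R i) : ℝ)) * (2 ^ net.cutRank S) ^ T) *
        ∏ i ∈ S, (msgCard T (R i) : ℝ) := by gcongr
    _ = _ := by ring

/-- The cut-set bound. -/
lemma Network.Achievable.sum_le_cutRank {net : Network N q} (h : net.Achievable R)
    (S : Finset (Fin N)) : ∑ i ∈ S, R i ≤ net.cutRank S := by
  obtain ⟨-, c, hc⟩ := h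
  by_contra! hlt
  have h1 : Filter.Tendsto
      (fun T : ℕ => ((2 : ℝ) ^ ((net.cutRank S : ℝ) - ∑ i ∈ S, R i)) ^ T)
      Filter.atTop (nhds 0) :=
    tendsto_pow_atTop_nhds_zero_of_lt_one (by positivity)
      (Real.rpow_lt_one_of_one_lt_of_neg one_lt_two (by linarith))
  have h2 := le_of_tendsto_of_tendsto' (hc.const_sub 1) h1
    fun T => net.one_sub_errorProb_le (c T) S
  norm_num at h2

end Converse

/-! ### One random time step -/

section Layer

variable (net : Network N q)

/-- The inputs of all nodes when every source node `i` applies the map `f i` to `k i`. -/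
def layerInput {K : Fin N → Type} (k : (i : Fin N) → K i) (f : (i : Fin N) → K i → Vec q) :
    Node N → Vec q
  | none => 0
  | some i => f i (k i)

open Classical in
/-- If every source node applies a uniformly random map to what it knows, then the probability
that two states of knowledge differing exactly on `S` are not distinguished outside `S` is
at most `2 ^ (-cutRank S)`. -/
lemma Network.card_layer_mul_le {K : Fin N → Type} [∀ i, Fintype (K i)] [∀ i, DecidableEq (K i)]
    (k k' : (i : Fin N) → K i) (S : Finset (Fin N)) (hS : ∀ i, i ∈ S ↔ k i ≠ k' i) :
    (Finset.univ.filter fun f : (i : Fin N) → K i → Vec q => ∀ j, j ∉ side S →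
      net.output (layerInput k f) j = net.output (layerInput k' f) j).card * 2 ^ net.cutRank S ≤
      Fintype.card ((i : Fin N) → K i → Vec q) := by
  classical
  let D : ((i : Fin N) → K i → Vec q) →ₗ[ZMod 2] (Node N → Vec q) :=
    { toFun := fun f => layerInput k f - layerInput k' f
      map_add' := fun f g => by ext (_ | i) <;> simp [layerInput]; ring
      map_smul' := fun a f => by ext (_ | i) <;> simp [layerInput]; ring }
  have hD (f) : (side S).indicator (D f) = D f := by
    rw [Set.indicator_eq_self]
    rintro (_ | i) hi
    · exact absurd rfl hi
    · by_contra h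
      refine hi ?_
      have : k i = k' i := by
        by_contra hne
        exact h ⟨i, (hS i).2 hne, rfl⟩
      simp [D, layerInput, this]
  let L := net.cutMap (side S) ∘ₗ D
  have hrange : LinearMap.range L = LinearMap.range (net.cutMap (side S)) := by
    refine le_antisymm (LinearMap.range_comp_le_range _ _) ?_
    rintro _ ⟨x, rfl⟩
    -- Any input on `S` is a difference: `k i ≠ k' i` there, so the values at the two points can be
    -- chosen independently.
    refine ⟨fun i κ => if κ = k i then x (some i) else 0, ?_⟩
    ext1 j
    by_cases hj : j ∈ side S
    · simp [L, net.cutMap_apply_of_mem _ hj]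
    · simp only [L, LinearMap.comp_apply]
      rw [net.cutMap_apply_of_notMem _ hj, net.cutMap_apply_of_notMem _ hj]
      congr 1
      ext1 v
      by_cases hv : v ∈ side S
      · rw [Set.indicator_of_mem hv, Set.indicator_of_mem hv]
        obtain ⟨i, hi, rfl⟩ := hv
        have : k' i ≠ k i := ((hS i).1 hi).symm
        simp [D, layerInput, this]
      · simp [hv]
  have hcard : Nat.card ((i : Fin N) → K i → Vec q) =
      Nat.card (LinearMap.ker L) * 2 ^ net.cutRank S := by
    rw [← card_range_cutMap, ← hrange, mul_comm]
    rw [Module.natCard_eq_pow_finrank (K := ZMod 2) (V := LinearMap.range L),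
      Module.natCard_eq_pow_finrank (K := ZMod 2) (V := LinearMap.ker L),
      Module.natCard_eq_pow_finrank (K := ZMod 2) (V := (i : Fin N) → K i → Vec q), ← pow_add,
      LinearMap.finrank_range_add_finrank_ker]
  rw [← Nat.card_eq_fintype_card, hcard]
  gcongr
  rw [← Fintype.card_subtype, ← Nat.card_eq_fintype_card]
  -- The maps being counted lie in the kernel of `L`.
  refine Nat.card_le_card_of_injective (fun f => ⟨f.1, ?_⟩) fun f g h =>
    Subtype.ext (congrArg (fun z => z.1) h)
  obtain ⟨f, hf⟩ := f
  rw [LinearMap.mem_ker]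
  ext1 j
  by_cases hj : j ∈ side S
  · exact net.cutMap_apply_of_mem _ hj
  · simp only [L, LinearMap.comp_apply]
    rw [net.cutMap_apply_of_notMem _ hj, hD]
    exact (net.output_sub _ _ j).trans (sub_eq_zero.2 (hf j hj))

end Layer

/-! ### Random coding by a potential function -/

section Achievability

variable (net : Network N q) {R : Fin N → ℝ}

/-- The source nodes that can distinguish the message tuples `w` and `w'` at time `t`. -/
def Network.distinguishing (c : Code N q T R) (w w' : Msg T R) (t : ℕ) : Finset (Fin N) :=
  open Classical in Finset.univ.filter fun i => w i ≠ w' i ∨ ∃ s : Fin T, (s : ℕ) < t ∧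
    net.received c w s (some i) ≠ net.received c w' s (some i)

/-- The destination cannot distinguish the message tuples `w` and `w'` at time `t`. -/
def Network.Confused (c : Code N q T R) (w w' : Msg T R) (t : ℕ) : Prop :=
  ∀ s : Fin T, (s : ℕ) < t → net.received c w s none = net.received c w' s none

/-- The source nodes whose messages differ. -/
def differing (w w' : Msg T R) : Finset (Fin N) := Finset.univ.filter fun i => w i ≠ w' i

open Classical in
/-- The contribution of a pair of message tuples to the potential of a code at time `t`. -/
def Network.pairPotential (δ : ℝ) (μ : Finset (Fin N) → ℝ) (c : Code N q T R) (w w' : Msg T R)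
    (t : ℕ) : ℝ :=
  if net.Confused c w w' t then
    δ ^ (net.distinguishing c w w' t).card * μ (differing w w') ^ (T - t)
  else 0

/-- The code with the encoders at time `t` replaced. -/
def Code.setLayer (c : Code N q T R) (t : Fin T)
    (f : (i : Fin N) → Fin (msgCard T (R i)) × (Fin (t : ℕ) → Vec q) → Vec q) : Code N q T R where
  enc i := Function.update (c.enc i) t fun m y => f i (m, y)
  dec := c.dec

/-- What the source nodes know at time `t`. -/
def Network.knowledge (c : Code N q T R) (w : Msg T R) (t : Fin T) (i : Fin N) :
    Fin (msgCard T (R i)) × (Fin (t : ℕ) → Vec q) :=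
  (w i, fun s => net.received c w ⟨s, s.2.trans t.2⟩ (some i))

lemma Network.received_setLayer_of_lt (c : Code N q T R) (w : Msg T R) (t : Fin T)
    (f : (i : Fin N) → Fin (msgCard T (R i)) × (Fin (t : ℕ) → Vec q) → Vec q) (s : Fin T)
    (h : s < t) : net.received (c.setLayer t f) w s = net.received c w s := by
  refine net.received_congr w s (fun i r hr => ?_) s le_rfl
  have : r ≠ t := (lt_of_le_of_lt (Fin.le_def.2 hr) h).ne
  simp [Code.setLayer, this]

lemma Network.received_setLayer_self (c : Code N q T R) (w : Msg T R) (t : Fin T)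
    (f : (i : Fin N) → Fin (msgCard T (R i)) × (Fin (t : ℕ) → Vec q) → Vec q) :
    net.received (c.setLayer t f) w t = net.output (layerInput (net.knowledge c w t) f) := by
  ext1 j
  rw [net.received_eq]
  congr 1
  ext1 v
  cases v with
  | none => rfl
  | some i =>
    simp only [Network.sent, Code.setLayer, Function.update_self, layerInput, Network.knowledge]
    congr 2
    ext1 s
    exact congrFun (net.received_setLayer_of_lt c w t f _ s.2) _

lemma Network.mem_distinguishing_iff (c : Code N q T R) (w w' : Msg T R) (t : Fin T) (i : Fin N) :
    i ∈ net.distinguishing c w w' t ↔ net.knowledge c w t i ≠ net.knowledge c w' t i := by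
  simp only [Network.distinguishing, Finset.mem_filter, Finset.mem_univ, true_and,
    Network.knowledge, ne_eq, Prod.mk.injEq, not_and_or, funext_iff, not_forall]
  refine or_congr Iff.rfl ⟨?_, ?_⟩
  · rintro ⟨s, hs, h⟩
    exact ⟨⟨s, hs⟩, h⟩
  · rintro ⟨s, h⟩
    exact ⟨⟨s, _⟩, s.2, h⟩

lemma Network.differing_subset (c : Code N q T R) (w w' : Msg T R) (t : ℕ) :
    differing w w' ⊆ net.distinguishing c w w' t := by
  intro i hi
  simp only [differing, Network.distinguishing, Finset.mem_filter, Finset.mem_univ,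
    true_and] at hi ⊢
  exact Or.inl hi

lemma Network.distinguishing_subset_setLayer (c : Code N q T R) (w w' : Msg T R) (t : Fin T)
    (f : (i : Fin N) → Fin (msgCard T (R i)) × (Fin (t : ℕ) → Vec q) → Vec q) :
    net.distinguishing c w w' t ⊆ net.distinguishing (c.setLayer t f) w w' (t + 1) := by
  intro i hi
  simp only [Network.distinguishing, Finset.mem_filter, Finset.mem_univ, true_and] at hi ⊢
  refine hi.imp_right ?_
  rintro ⟨s, hs, h⟩
  refine ⟨s, by omega, ?_⟩
  rwa [net.received_setLayer_of_lt c w t f s hs, net.received_setLayer_of_lt c w' t f s hs]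

lemma Network.Confused.of_setLayer {net : Network N q} {c : Code N q T R} {w w' : Msg T R}
    {t : Fin T} {f : (i : Fin N) → Fin (msgCard T (R i)) × (Fin (t : ℕ) → Vec q) → Vec q}
    (h : net.Confused (c.setLayer t f) w w' (t + 1)) : net.Confused c w w' t := by
  intro s hs
  have := h s (by omega)
  rwa [net.received_setLayer_of_lt c w t f s hs, net.received_setLayer_of_lt c w' t f s hs] at this

variable {δ : ℝ} {μ : Finset (Fin N) → ℝ}

-- If no difference shows outside `A`, the factor is at most `1`; if one shows and the pair stays
-- confused, `A` gains a node, giving a factor `δ`.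
open Classical in
lemma Network.pairPotential_setLayer_le (hδ : 0 < δ) (hδ1 : δ ≤ 1) (hμ : ∀ S, 0 ≤ μ S)
    (c : Code N q T R) (w w' : Msg T R) (t : Fin T)
    (f : (i : Fin N) → Fin (msgCard T (R i)) × (Fin (t : ℕ) → Vec q) → Vec q) :
    net.pairPotential δ μ (c.setLayer t f) w w' (t + 1) ≤
      ((if ∀ j, j ∉ side (net.distinguishing c w w' t) →
          net.output (layerInput (net.knowledge c w t) f) j =
            net.output (layerInput (net.knowledge c w' t) f) j then 1 else 0) + δ) *
        (δ ^ (net.distinguishing c w w' t).card * μ (differing w w') ^ (T - (t + 1))) := by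
  set A := net.distinguishing c w w' t with hA
  set A' := net.distinguishing (c.setLayer t f) w w' (t + 1) with hA'
  have hsub : A ⊆ A' := net.distinguishing_subset_setLayer c w w' t f
  have hm : 0 ≤ μ (differing w w') ^ (T - (t + 1)) := pow_nonneg (hμ _) _
  have hp : 0 ≤ δ ^ A.card := by positivity
  rw [Network.pairPotential]
  split_ifs with hconf hbad hbad
  · have : δ ^ A'.card ≤ δ ^ A.card :=
      pow_le_pow_of_le_one hδ.le hδ1 (Finset.card_le_card hsub)
    calc _ ≤ δ ^ A.card * μ (differing w w') ^ (T - (t + 1)) := by gcongr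
      _ ≤ _ := le_mul_of_one_le_left (by positivity) (by linarith)
  · have hlt : A.card + 1 ≤ A'.card := by
      refine Finset.card_lt_card (Finset.ssubset_iff_subset_ne.2 ⟨hsub, fun heq => hbad ?_⟩)
      intro j hj
      rw [← net.received_setLayer_self, ← net.received_setLayer_self]
      cases j with
      | none => exact hconf t (by omega)
      | some i =>
        by_contra hne
        refine hj ⟨i, ?_, rfl⟩
        rw [Finset.mem_coe, heq, hA']
        simp only [Network.distinguishing, Finset.mem_filter, Finset.mem_univ, true_and]
        exact Or.inr ⟨t, by omega, hne⟩
    have : δ ^ A'.card ≤ δ ^ (A.card + 1) := pow_le_pow_of_le_one hδ.le hδ1 hlt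
    calc _ ≤ δ ^ (A.card + 1) * μ (differing w w') ^ (T - (t + 1)) := by gcongr
      _ = _ := by ring
  · positivity
  · positivity

open Classical in
/-- Choosing the encoders of one time step uniformly at random does not increase the expected
contribution of a pair. -/
lemma Network.sum_pairPotential_setLayer_le (hδ : 0 < δ) (hδ1 : δ ≤ 1)
    (hμ : ∀ S A, S ⊆ A → (2 ^ net.cutRank A : ℝ)⁻¹ + δ ≤ μ S)
    (c : Code N q T R) (w w' : Msg T R) (t : Fin T) :
    ∑ f : (i : Fin N) → Fin (msgCard T (R i)) × (Fin (t : ℕ) → Vec q) → Vec q,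
        net.pairPotential δ μ (c.setLayer t f) w w' (t + 1) ≤
      ∑ _f : (i : Fin N) → Fin (msgCard T (R i)) × (Fin (t : ℕ) → Vec q) → Vec q,
        net.pairPotential δ μ c w w' t := by
  have hμ0 (S) : 0 ≤ μ S := le_trans (by positivity) (hμ S S subset_rfl)
  by_cases hconf : net.Confused c w w' t
  swap
  -- Once separated, a pair stays separated: both sides are zero.
  · refine Finset.sum_le_sum fun f _ => ?_
    rw [Network.pairPotential, Network.pairPotential, if_neg hconf,
      if_neg fun h => hconf h.of_setLayer]
  refine (Finset.sum_le_sum fun f _ =>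
    net.pairPotential_setLayer_le hδ hδ1 hμ0 c w w' t f).trans ?_
  set A := net.distinguishing c w w' t with hA
  have hcard := net.card_layer_mul_le (net.knowledge c w t) (net.knowledge c w' t) A
    fun i => net.mem_distinguishing_iff c w w' t i
  set B := Finset.univ.filter fun f : (i : Fin N) → Fin (msgCard T (R i)) ×
    (Fin (t : ℕ) → Vec q) → Vec q => ∀ j, j ∉ side A →
      net.output (layerInput (net.knowledge c w t) f) j =
        net.output (layerInput (net.knowledge c w' t) f) j with hB
  set n := Fintype.card ((i : Fin N) → Fin (msgCard T (R i)) × (Fin (t : ℕ) → Vec q) → Vec q)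
  have hcard' : (B.card : ℝ) ≤ n * (2 ^ net.cutRank A : ℝ)⁻¹ := by
    rw [← div_eq_mul_inv, le_div_iff₀ (by positivity)]
    exact_mod_cast hcard
  have hm : 0 ≤ μ (differing w w') ^ (T - (t + 1)) := pow_nonneg (hμ0 _) _
  -- The spare factor `μ` released by `T - t` pays for the expected growth factor.
  rw [← Finset.sum_mul, Finset.sum_add_distrib, Finset.sum_boole, Finset.sum_const,
    Finset.sum_const, Finset.card_univ, nsmul_eq_mul, nsmul_eq_mul, Network.pairPotential,
    if_pos hconf, show T - (t : ℕ) = (T - (t + 1)) + 1 by omega, pow_succ]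
  calc _ ≤ (n * (2 ^ net.cutRank A : ℝ)⁻¹ + n * δ) *
        (δ ^ A.card * μ (differing w w') ^ (T - (t + 1))) := by gcongr
    _ = ((2 ^ net.cutRank A : ℝ)⁻¹ + δ) *
        (n * (δ ^ A.card * μ (differing w w') ^ (T - (t + 1)))) := by ring
    _ ≤ μ (differing w w') * (n * (δ ^ A.card * μ (differing w w') ^ (T - (t + 1)))) := by
      gcongr
      exact hμ _ _ (net.differing_subset c w w' t)
    _ = _ := by ring

/-- The potential of a code at time `t`, an upper bound for the number of confused pairs. -/
def Network.potential (δ : ℝ) (μ : Finset (Fin N) → ℝ) (c : Code N q T R) (t : ℕ) : ℝ :=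
  ∑ w : Msg T R, ∑ w' ∈ Finset.univ.erase w, net.pairPotential δ μ c w w' t

/-- Derandomization one time step at a time: some choice of encoders does no worse than the average.
-/
lemma Network.exists_potential_le (hδ : 0 < δ) (hδ1 : δ ≤ 1)
    (hμ : ∀ S A, S ⊆ A → (2 ^ net.cutRank A : ℝ)⁻¹ + δ ≤ μ S) {t : ℕ} (ht : t ≤ T) :
    ∃ c : Code N q T R, net.potential δ μ c t ≤
      ∑ w : Msg T R, ∑ w' ∈ Finset.univ.erase w, μ (differing w w') ^ T := by
  classical
  have hμ0 (S) : 0 ≤ μ S := le_trans (by positivity) (hμ S S subset_rfl)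
  induction t with
  | zero =>
    refine ⟨⟨fun _ _ _ _ => 0, fun _ => Classical.arbitrary _⟩, ?_⟩
    refine Finset.sum_le_sum fun w _ => Finset.sum_le_sum fun w' _ => ?_
    rw [Network.pairPotential]
    have := pow_nonneg (hμ0 (differing w w')) T
    split_ifs
    · exact mul_le_of_le_one_left this (pow_le_one₀ hδ.le hδ1)
    · exact this
  | succ t ih =>
    obtain ⟨c, hc⟩ := ih (by omega)
    let t' : Fin T := ⟨t, ht⟩
    have hsum : ∑ f : (i : Fin N) → Fin (msgCard T (R i)) × (Fin (t' : ℕ) → Vec q) → Vec q,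
          net.potential δ μ (c.setLayer t' f) (t + 1) ≤
        ∑ _f : (i : Fin N) → Fin (msgCard T (R i)) × (Fin (t' : ℕ) → Vec q) → Vec q,
          net.potential δ μ c t := by
      unfold Network.potential
      refine (Finset.sum_comm.trans_le (Finset.sum_le_sum fun w _ => ?_)).trans_eq Finset.sum_comm
      refine (Finset.sum_comm.trans_le ?_).trans_eq Finset.sum_comm
      exact Finset.sum_le_sum fun w' _ => net.sum_pairPotential_setLayer_le hδ hδ1 hμ c w w' t'
    obtain ⟨f, -, hf⟩ := Finset.exists_le_of_sum_le Finset.univ_nonempty hsum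
    exact ⟨_, hf.trans hc⟩

/-- The code with the decoder replaced by one that inverts the map from the messages to the
outputs of the destination as far as possible. -/
def Network.withInverseDecoder (c : Code N q T R) : Code N q T R where
  enc := c.enc
  dec := Function.invFun fun w t => net.received c w t none

lemma Network.confused_withInverseDecoder (c : Code N q T R) (w : Msg T R) :
    net.Confused c w (net.decoded (net.withInverseDecoder c) w) T := by
  have h : ∀ (w : Msg T R) (t : Fin T),
      net.received (net.withInverseDecoder c) w t = net.received c w t := fun w t =>
    net.received_congr (c := net.withInverseDecoder c) (c' := c) w t (fun _ _ _ => rfl) t le_rfl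
  intro t _
  have hinv := Function.invFun_eq (f := fun (w : Msg T R) t => net.received c w t none) ⟨w, rfl⟩
  simp only [Network.decoded, h]
  exact (congrFun hinv t).symm

/-- A wrongly decoded `w` is confused with its decoded tuple. At time `T` that pair alone
contributes at least `δ ^ N`, since at most `N` source nodes distinguish it. -/
lemma Network.errorProb_withInverseDecoder_le (hδ : 0 < δ) (hδ1 : δ ≤ 1) (hμ : ∀ S, 0 ≤ μ S)
    (c : Code N q T R) :
    net.errorProb (net.withInverseDecoder c) * δ ^ N ≤
      net.potential δ μ c T / Fintype.card (Msg T R) := by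
  classical
  rw [Network.errorProb, div_mul_eq_mul_div]
  gcongr
  have hnn (w w' : Msg T R) : 0 ≤ net.pairPotential δ μ c w w' T := by
    rw [Network.pairPotential]
    have := hμ (differing w w')
    split_ifs <;> positivity
  rw [Finset.card_filter, Nat.cast_sum, Finset.sum_mul]
  refine Finset.sum_le_sum fun w _ => ?_
  by_cases h : net.decoded (net.withInverseDecoder c) w = w
  · rw [if_neg (not_not.2 h), Nat.cast_zero, zero_mul]
    exact Finset.sum_nonneg fun w' _ => hnn w w'
  · rw [if_pos h, Nat.cast_one, one_mul]
    refine le_trans ?_ (Finset.single_le_sum (fun w' _ => hnn w w')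
      (Finset.mem_erase.2 ⟨h, Finset.mem_univ _⟩))
    rw [Network.pairPotential, if_pos (net.confused_withInverseDecoder c w), Nat.sub_self,
      pow_zero, mul_one]
    exact pow_le_pow_of_le_one hδ.le hδ1 ((Finset.card_le_univ _).trans_eq (Fintype.card_fin N))

/-- The `- 1` matters twice later: it absorbs the rounding in `msgCard`, and it kills every `S`
containing a node of rate zero. -/
lemma card_differing_eq_le (w : Msg T R) (S : Finset (Fin N)) :
    (Finset.univ.filter fun w' => differing w w' = S).card ≤ ∏ i ∈ S, (msgCard T (R i) - 1) := by
  classical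
  have hle : (Finset.univ.filter fun w' => differing w w' = S) ⊆
      Fintype.piFinset fun i => if i ∈ S then Finset.univ.erase (w i) else {w i} := by
    intro w' hw'
    rw [Finset.mem_filter] at hw'
    rw [Fintype.mem_piFinset]
    intro i
    have : i ∈ S ↔ w i ≠ w' i := by simp [← hw'.2, differing]
    split_ifs with h
    · simpa using (this.1 h).symm
    · simpa using (not_not.1 (mt this.2 h)).symm
  refine (Finset.card_le_card hle).trans_eq ?_
  rw [Fintype.card_piFinset, ← Finset.prod_subset (Finset.subset_univ S)]
  · exact Finset.prod_congr rfl fun i hi => by simp [hi]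
  · intro i _ hi
    simp [hi]

lemma sum_pow_differing_le (hμ : ∀ S, 0 ≤ μ S) (w : Msg T R) :
    ∑ w' ∈ Finset.univ.erase w, μ (differing w w') ^ T ≤
      ∑ S ∈ Finset.univ.erase ∅, ((∏ i ∈ S, (msgCard T (R i) - 1) : ℕ) : ℝ) * μ S ^ T := by
  classical
  rw [← Finset.sum_fiberwise_of_maps_to (t := Finset.univ.erase ∅)
    (g := fun w' => differing w w')]
  · refine Finset.sum_le_sum fun S _ => ?_
    rw [Finset.sum_congr rfl fun w' hw' => by rw [(Finset.mem_filter.1 hw').2], Finset.sum_const,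
      nsmul_eq_mul]
    have := pow_nonneg (hμ S) T
    gcongr
    refine (Finset.card_le_card ?_).trans (card_differing_eq_le w S)
    exact Finset.filter_subset_filter _ (Finset.subset_univ _)
  · intro w' hw'
    refine Finset.mem_erase.2 ⟨fun h => (Finset.mem_erase.1 hw').1 ?_, Finset.mem_univ _⟩
    ext1 i
    by_contra hi
    have : i ∈ differing w w' := by simpa [differing] using fun h => hi h.symm
    simp [h] at this

lemma Network.exists_errorProb_le (R : Fin N → ℝ) (hδ : 0 < δ) (hδ1 : δ ≤ 1)
    (hμ : ∀ S A, S ⊆ A → (2 ^ net.cutRank A : ℝ)⁻¹ + δ ≤ μ S) (T : ℕ) :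
    ∃ c : Code N q T R, net.errorProb c * δ ^ N ≤
      ∑ S ∈ Finset.univ.erase ∅, ((∏ i ∈ S, (msgCard T (R i) - 1) : ℕ) : ℝ) * μ S ^ T := by
  have hμ0 (S) : 0 ≤ μ S := le_trans (by positivity) (hμ S S subset_rfl)
  obtain ⟨c, hc⟩ := net.exists_potential_le (R := R) hδ hδ1 hμ (le_refl T)
  have hpos : (0 : ℝ) < Fintype.card (Msg T R) := by exact_mod_cast Fintype.card_pos
  refine ⟨_, (net.errorProb_withInverseDecoder_le hδ hδ1 hμ0 c).trans ?_⟩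
  rw [div_le_iff₀ hpos]
  refine hc.trans ((Finset.sum_le_sum fun w _ => sum_pow_differing_le hμ0 w).trans_eq ?_)
  rw [Finset.sum_const, Finset.card_univ, nsmul_eq_mul, mul_comm]

lemma prod_msgCard_sub_one_le (T : ℕ) (R : Fin N → ℝ) (S : Finset (Fin N)) :
    ((∏ i ∈ S, (msgCard T (R i) - 1) : ℕ) : ℝ) ≤ ((2 : ℝ) ^ (∑ i ∈ S, R i)) ^ T := by
  rw [← Real.rpow_natCast, ← Real.rpow_mul two_pos.le, mul_comm, Finset.mul_sum,
    Real.rpow_sum_of_pos two_pos, Nat.cast_prod]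
  refine Finset.prod_le_prod (fun _ _ => by positivity) fun i _ => ?_
  have h1 : 1 ≤ msgCard T (R i) := Nat.ceil_pos.2 (by positivity)
  have h2 : (msgCard T (R i) : ℝ) < 2 ^ ((T : ℝ) * R i) + 1 := Nat.ceil_lt_add_one (by positivity)
  push_cast [h1]
  linarith

/-- Rates in the cut-set region become achievable when scaled down. -/
lemma Network.achievable_mul (hR : ∀ i, 0 ≤ R i)
    (hcut : ∀ S : Finset (Fin N), ∑ i ∈ S, R i ≤ net.cutRank S) {θ : ℝ} (hθ : 0 ≤ θ)
    (hθ1 : θ < 1) : net.Achievable fun i => θ * R i := by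
  classical
  -- At `δ = 0` the product is `2 ^ ((θ - 1) * ∑ i ∈ S, R i) < 1`; continuity and finitely many `S`
  -- allow a positive `δ`.
  have hδ : ∀ᶠ δ : ℝ in nhdsWithin 0 (Set.Ioi 0), 0 < δ ∧ δ ≤ 1 ∧ ∀ S : Finset (Fin N),
      0 < ∑ i ∈ S, R i → 2 ^ (∑ i ∈ S, θ * R i) * ((2 : ℝ) ^ (-∑ i ∈ S, R i) + δ) < 1 := by
    refine Filter.Eventually.and self_mem_nhdsWithin (Filter.Eventually.and ?_ ?_)
    · exact nhdsWithin_le_nhds (Iic_mem_nhds one_pos)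
    · rw [Filter.eventually_all]
      intro S
      by_cases hS : 0 < ∑ i ∈ S, R i
      · have hcont : Continuous fun δ : ℝ =>
            (2 : ℝ) ^ (∑ i ∈ S, θ * R i) * ((2 : ℝ) ^ (-∑ i ∈ S, R i) + δ) := by fun_prop
        have hlt : (2 : ℝ) ^ (∑ i ∈ S, θ * R i) * ((2 : ℝ) ^ (-∑ i ∈ S, R i) + 0) < 1 := by
          rw [add_zero, ← Real.rpow_add two_pos, ← Finset.mul_sum]
          exact Real.rpow_lt_one_of_one_lt_of_neg one_lt_two (by nlinarith)
        exact nhdsWithin_le_nhds ((hcont.tendsto 0).eventually_lt_const hlt |>.mono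
          fun _ h _ => h)
      · exact Filter.Eventually.of_forall fun _ h => absurd h hS
  obtain ⟨δ, hδ0, hδ1, hδS⟩ := hδ.exists
  have hμ : ∀ S A : Finset (Fin N), S ⊆ A →
      (2 ^ net.cutRank A : ℝ)⁻¹ + δ ≤ 2 ^ (-∑ i ∈ S, R i) + δ := by
    intro S A hSA
    gcongr
    rw [← Real.rpow_natCast, ← Real.rpow_neg two_pos.le]
    refine Real.rpow_le_rpow_of_exponent_le one_le_two (neg_le_neg ?_)
    exact (Finset.sum_le_sum_of_subset_of_nonneg hSA fun i _ _ => hR i).trans (hcut A)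
  choose c hc using net.exists_errorProb_le (fun i => θ * R i) hδ0 hδ1 hμ
  refine ⟨fun i => mul_nonneg hθ (hR i), c, ?_⟩
  have hterm : ∀ S ∈ Finset.univ.erase (∅ : Finset (Fin N)), Filter.Tendsto
      (fun T : ℕ => ((∏ i ∈ S, (msgCard T (θ * R i) - 1) : ℕ) : ℝ) *
        ((2 : ℝ) ^ (-∑ i ∈ S, R i) + δ) ^ T) Filter.atTop (nhds 0) := by
    intro S hS
    -- A node of rate zero has a single message, so no pair differs there.
    by_cases hzero : ∃ i ∈ S, R i = 0
    · obtain ⟨i, hi, h0⟩ := hzero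
      have : ∀ T : ℕ, ∏ i ∈ S, (msgCard T (θ * R i) - 1) = 0 := fun T =>
        Finset.prod_eq_zero hi (by simp [msgCard, h0])
      simp [this]
    · push Not at hzero
      have hpos : 0 < ∑ i ∈ S, R i := Finset.sum_pos
        (fun i hi => lt_of_le_of_ne (hR i) (hzero i hi).symm)
        (Finset.nonempty_iff_ne_empty.2 (Finset.mem_erase.1 hS).1)
      refine squeeze_zero (fun T => by positivity) (fun T => ?_)
        (tendsto_pow_atTop_nhds_zero_of_lt_one (by positivity) (hδS S hpos))
      rw [mul_pow]
      gcongr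
      exact prod_msgCard_sub_one_le T (fun i => θ * R i) S
  have hlim := (tendsto_finsetSum _ hterm).div_const (δ ^ N)
  rw [Finset.sum_const_zero, zero_div] at hlim
  refine squeeze_zero (fun T => by unfold Network.errorProb; positivity) (fun T => ?_) hlim
  rw [le_div_iff₀ (by positivity)]
  exact hc T

end Achievability

end DetNet

end

/-! ### The capacity region -/

theorem theorem1 (N q : ℕ) (net : DetNet.Network N q) :
    net.capacityRegion =
      {R : Fin N → ℝ | (∀ i, 0 ≤ R i) ∧
        ∀ S : Finset (Fin N), ∑ i ∈ S, R i ≤ (net.cutRank S : ℝ)} := by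
  refine subset_antisymm (closure_minimal ?_ ?_) ?_
  · exact fun R hR => ⟨hR.1, fun S => hR.sum_le_cutRank S⟩
  · simp only [Set.ofPred_and, Set.ofPred_forall]
    refine IsClosed.inter (isClosed_iInter fun i => ?_) (isClosed_iInter fun S => ?_)
    · exact isClosed_le continuous_const (continuous_apply i)
    · exact isClosed_le (by fun_prop) continuous_const
  · rintro R ⟨hR, hcut⟩
    have hlim : Filter.Tendsto (fun θ : ℝ => fun i => θ * R i)
        (nhdsWithin 1 (Set.Iio 1)) (nhds R) := by
      have hcont : Continuous fun θ : ℝ => fun i => θ * R i := by fun_prop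
      simpa using (hcont.tendsto 1).mono_left nhdsWithin_le_nhds
    refine mem_closure_of_tendsto hlim ?_
    have h0 : ∀ᶠ θ : ℝ in nhdsWithin 1 (Set.Iio 1), 0 ≤ θ :=
      nhdsWithin_le_nhds (Ici_mem_nhds one_pos)
    filter_upwards [h0, self_mem_nhdsWithin] with θ hθ hθ1
    exact net.achievable_mul hR hcut hθ hθ1
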